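/- Let $n\ge 0$ be an integer, and let $P_2(\mathbb{R}^n)$ be the set of Borel probability measures $\mu$ on $\mathbb{R}^n$ with $\int_{\mathbb{R}^n}|x|^2\,d\mu(x)<\infty$. For $\nu,\mu\in P_2(\mathbb{R}^n)$ let $$W_2^2(\nu,\mu)=\inf_{\gamma}\int_{\mathbb{R}^n\times\mathbb{R}^n}|x-y|^2\,d\gamma(x,y),$$ where the infimum is over all Borel probability measures $\gamma$ on $\mathbb{R}^n\times\mathbb{R}^n$ whose projections to the first and second factor are $\nu$ and $\mu$, respectively. Fix $\nu\in P_2(\mathbb{R}^n)$. Then $W_2^2(\nu,\mu)<\infty$ for every $\mu\in P_2(\mathbb{R}^n)$, and the function $\mu\mapsto W_2^2(\nu,\mu)$ is convex on $P_2(\mathbb{R}^n)$ with respect to the usual linear structure on measures: for all $\mu_0,\mu_1\in P_2(\mathbb{R}^n)$ and $s\in[0,1]$, the mixture $(1-s)\mu_0+s\mu_1$ belongs to $P_2(\mathbb{R}^n)$ and $$W_2^2\bigl(\nu,(1-s)\mu_0+s\mu_1\bigr)\le (1-s)\,W_2^2(\nu,\mu_0)+s\,W_2^2(\nu,\mu_1).$$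 If $\nu$ is absolutely continuous with respect to Lebesgue measure, then the function is strictly convex: the inequality is strict whenever $\mu_0\ne\mu_1$ and $0<s<1$. -/

import Mathlib

open MeasureTheory
open scoped ENNReal NNReal

/-- `P₂(ℝⁿ)`: the Borel probability measures on Euclidean `ℝⁿ` with finite second moment. -/
def P2 (n : ℕ) : Set (Measure (EuclideanSpace ℝ (Fin n))) :=
  {μ | IsProbabilityMeasure μ ∧ ∫⁻ x, ‖x‖ₑ ^ 2 ∂μ < ∞}

/-- The couplings of `ν` and `μ`: Borel probability measures on `ℝⁿ × ℝⁿ` whose projections to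
the first and second factor are `ν` and `μ`. -/
def couplings {n : ℕ} (ν μ : Measure (EuclideanSpace ℝ (Fin n))) :
    Set (Measure (EuclideanSpace ℝ (Fin n) × EuclideanSpace ℝ (Fin n))) :=
  {γ | IsProbabilityMeasure γ ∧ γ.map Prod.fst = ν ∧ γ.map Prod.snd = μ}

/-- The squared quadratic Wasserstein distance `W₂²(ν, μ) = inf ∫ |x - y|² dγ(x, y)`, the infimum
running over all couplings `γ` of `ν` and `μ`, as an extended nonnegative real number. -/
noncomputable def W2sq {n : ℕ} (ν μ : Measure (EuclideanSpace ℝ (Fin n))) : ℝ≥0∞ :=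
  ⨅ γ ∈ couplings ν μ, ∫⁻ p, ‖p.1 - p.2‖ₑ ^ 2 ∂γ

/-! Convexity: mixing optimal couplings for `μ₀` and `μ₁` gives a coupling for the mixture, whose
cost is the mixture of the costs. Strictness: if equality held, this mixed coupling would be optimal
with finite cost, so its support would be monotone (`isMonotoneRel_support_of_optimal`), since
otherwise exchanging targets would lower the cost. Both original couplings live on that support. A
monotone relation is single-valued Lebesgue almost everywhere
(`IsMonotoneRel.addHaar_multivalued_eq_zero`), so when `ν ≪ volume` the two couplings are induced by
the same map, and `μ₀ = μ₁` (`eq_of_couplings_of_isMonotoneRel`). -/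

/-! ### Monotone relations and their almost everywhere single-valuedness. -/

section MonotoneRelation

variable {E : Type*} [NormedAddCommGroup E] [InnerProductSpace ℝ E]

/-- A relation on an inner product space, given by its graph, is monotone if
`⟪x - x', y - y'⟫ ≥ 0` for all related pairs `(x, y)`, `(x', y')`. -/
def IsMonotoneRel (G : Set (E × E)) : Prop :=
  ∀ p ∈ G, ∀ q ∈ G, 0 ≤ inner ℝ (p.1 - q.1) (p.2 - q.2)

/-- The relation whose fibers are the convex hulls of the fibers of `G`. -/
def fiberHull (G : Set (E × E)) : Set (E × E) :=
  {p | p.2 ∈ convexHull ℝ {y | (p.1, y) ∈ G}}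

theorem subset_fiberHull (G : Set (E × E)) : G ⊆ fiberHull G :=
  fun p hp => subset_convexHull ℝ {y | (p.1, y) ∈ G} hp

theorem convex_setOf_inner_sub_nonneg (v w : E) : Convex ℝ {y : E | 0 ≤ inner ℝ v (y - w)} := by
  have : {y : E | 0 ≤ inner ℝ v (y - w)} = {y | inner ℝ v w ≤ innerSL ℝ v y} := by
    ext y; simp [inner_sub_right]
  rw [this]
  exact convex_halfSpace_ge (innerSL ℝ v).isLinear _

/-- With base points fixed, the inequality is affine in each target separately, so it passes to the
hull of one fiber at a time. -/
theorem IsMonotoneRel.fiberHull {G : Set (E × E)} (hG : IsMonotoneRel G) :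
    IsMonotoneRel (fiberHull G) := by
  have key : ∀ p ∈ _root_.fiberHull G, ∀ q ∈ G, 0 ≤ inner ℝ (p.1 - q.1) (p.2 - q.2) := by
    intro p hp q hq
    exact convexHull_min (s := {y | (p.1, y) ∈ G}) (fun y hy => hG (p.1, y) hy q hq)
      (convex_setOf_inner_sub_nonneg (p.1 - q.1) q.2) hp
  intro p hp q hq
  have h := convexHull_min (s := {y | (q.1, y) ∈ G}) (fun y hy => by
      have := key p hp (q.1, y) hy
      rw [← inner_neg_neg, neg_sub, neg_sub] at this
      exact this)
    (convex_setOf_inner_sub_nonneg (q.1 - p.1) p.2) hq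
  rw [← inner_neg_neg, neg_sub, neg_sub]
  exact h

theorem IsMonotoneRel.dist_fst_le {G : Set (E × E)} (hG : IsMonotoneRel G) {p q : E × E}
    (hp : p ∈ G) (hq : q ∈ G) : dist p.1 q.1 ≤ dist (p.1 + p.2) (q.1 + q.2) := by
  rw [dist_eq_norm, dist_eq_norm]
  have h := hG p hp q hq
  have e : (p.1 + p.2) - (q.1 + q.2) = (p.1 - q.1) + (p.2 - q.2) := by abel
  rw [e]
  have := norm_add_sq_real (p.1 - q.1) (p.2 - q.2)
  refine le_of_sq_le_sq ?_ (norm_nonneg _)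
  nlinarith [sq_nonneg ‖p.2 - q.2‖]

/-- The resolvent `x + y ↦ x` of a monotone relation is nonexpansive. -/
theorem IsMonotoneRel.exists_resolvent {G : Set (E × E)} (hG : IsMonotoneRel G) :
    ∃ F : E → E, LipschitzOnWith 1 F ((fun p : E × E => p.1 + p.2) '' G) ∧
      ∀ p ∈ G, F (p.1 + p.2) = p.1 := by
  classical
  let F : E → E := fun z => if h : ∃ p ∈ G, p.1 + p.2 = z then h.choose.1 else 0
  have hF : ∀ p ∈ G, F (p.1 + p.2) = p.1 := by
    intro p hp
    have h : ∃ q ∈ G, q.1 + q.2 = p.1 + p.2 := ⟨p, hp, rfl⟩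
    have hc := h.choose_spec
    simp only [F, dif_pos h]
    have := hG.dist_fst_le hc.1 hp
    rw [hc.2, dist_self] at this
    exact dist_le_zero.1 this
  refine ⟨F, ?_, hF⟩
  refine LipschitzOnWith.of_dist_le_mul ?_
  rintro _ ⟨p, hp, rfl⟩ _ ⟨q, hq, rfl⟩
  simp only [hF p hp, hF q hq, NNReal.coe_one, one_mul]
  exact hG.dist_fst_le hp hq

theorem HasFDerivAt.apply_eq_zero_of_segment {F : Type*} [NormedAddCommGroup F] [NormedSpace ℝ F]
    {g : E → F} {g' : E →L[ℝ] F} {z v : E} (hg : HasFDerivAt g g' z)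
    (h : ∀ t ∈ Set.Icc (0 : ℝ) 1, g (z + t • v) = g z) : g' v = 0 := by
  have h1 : HasDerivAt (fun t : ℝ => z + t • v) v 0 := by
    simpa using ((hasDerivAt_id (0 : ℝ)).smul_const v).const_add z
  have h2 : HasDerivAt (fun t : ℝ => g (z + t • v)) (g' v) 0 := by
    have hg0 : HasFDerivAt g g' (z + (0 : ℝ) • v) := by simpa using hg
    exact hg0.comp_hasDerivAt (0 : ℝ) h1
  have h3 : HasDerivWithinAt (fun _ : ℝ => g z) (g' v) (Set.Icc 0 1) 0 :=
    h2.hasDerivWithinAt.congr (fun t ht => (h t ht).symm) (by simp)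
  exact ((uniqueDiffOn_Icc zero_lt_one) 0 (by simp)).eq_deriv _ h3
    (hasDerivWithinAt_const _ _ _)

variable [FiniteDimensional ℝ E] [MeasurableSpace E] [BorelSpace E]

theorem LipschitzWith.addHaar_image_eq_zero (μ : Measure E) [μ.IsAddHaarMeasure] {K : ℝ≥0}
    {g : E → E} (hg : LipschitzWith K g) {s : Set E} (hs : μ s = 0) : μ (g '' s) = 0 := by
  have hH : μH[(Module.finrank ℝ E : ℝ)] s = 0 :=
    Measure.absolutelyContinuous_isAddHaarMeasure (μH[(Module.finrank ℝ E : ℝ)]) μ hs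
  refine Measure.absolutelyContinuous_isAddHaarMeasure μ (μH[(Module.finrank ℝ E : ℝ)]) ?_
  refine le_antisymm ((hg.hausdorffMeasure_image_le (by positivity) s).trans ?_) zero_le
  simp [hH]

/-- A monotone relation on a finite-dimensional space is single-valued almost everywhere. -/
theorem IsMonotoneRel.addHaar_multivalued_eq_zero (μ : Measure E) [μ.IsAddHaarMeasure]
    {G : Set (E × E)} (hG : IsMonotoneRel G) :
    μ {x | ∃ y y', y ≠ y' ∧ (x, y) ∈ G ∧ (x, y') ∈ G} = 0 := by
  obtain ⟨F, hFL, hF⟩ := hG.fiberHull.exists_resolvent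
  obtain ⟨g, hgL, hg⟩ := hFL.extend_finite_dimension
  have hgG : ∀ p ∈ _root_.fiberHull G, g (p.1 + p.2) = p.1 := fun p hp =>
    (hg (Set.mem_image_of_mem _ hp)).symm.trans (hF p hp)
  -- Every multivalued point `x` is a value `g (x + y)`. Non-differentiability points are null by
  -- Rademacher and have null image since `g` is Lipschitz; critical points have null image by the
  -- easy case of Sard.
  let N : Set E := {z | ¬ DifferentiableAt ℝ g z}
  let T : Set E := {z | DifferentiableAt ℝ g z ∧ (fderiv ℝ g z).det = 0}
  have hN : μ (g '' N) = 0 := hgL.addHaar_image_eq_zero μ hgL.ae_differentiableAt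
  have hT : μ (g '' T) = 0 :=
    addHaar_image_eq_zero_of_det_fderivWithin_eq_zero μ
      (fun z hz => hz.1.hasFDerivAt.hasFDerivWithinAt) (fun z hz => hz.2)
  refine measure_mono_null ?_ (measure_union_null hN hT)
  rintro x ⟨y, y', hne, hy, hy'⟩
  have hx : g (x + y) = x := hgG (x, y) (subset_fiberHull G hy)
  by_cases hd : DifferentiableAt ℝ g (x + y)
  · refine Or.inr ⟨x + y, ⟨hd, ?_⟩, hx⟩
    -- Fibers of the hull are convex, so `g` equals `x` on the whole segment from `x + y` to `x +
    -- y'`.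
    have hker : fderiv ℝ g (x + y) (y' - y) = 0 := by
      refine hd.hasFDerivAt.apply_eq_zero_of_segment fun t ht => ?_
      have hmem : (x, y + t • (y' - y)) ∈ _root_.fiberHull G :=
        (convex_convexHull ℝ {w | (x, w) ∈ G}).add_smul_sub_mem
          (subset_convexHull ℝ {w | (x, w) ∈ G} hy) (subset_convexHull ℝ {w | (x, w) ∈ G} hy') ht
      rw [hx, add_assoc]
      exact hgG _ hmem
    refine LinearMap.det_eq_zero_iff_ker_ne_bot.2 fun hbot => hne ?_
    have hmem : y' - y ∈ LinearMap.ker (fderiv ℝ g (x + y) : E →ₗ[ℝ] E) := hker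
    rw [hbot, Submodule.mem_bot] at hmem
    exact (sub_eq_zero.1 hmem).symm
  · exact Or.inl ⟨x + y, hd, hx⟩

end MonotoneRelation

/-! ### Lower semicontinuity of the cost under weak convergence. -/

section WeakConvergence

open Topology

/-- The integral is the supremum over `N` of the integrals of the bounded truncations `min f N`,
which are weakly continuous. -/
theorem lowerSemicontinuous_lintegral_coe {Ω : Type*} [MeasurableSpace Ω] [TopologicalSpace Ω]
    [OpensMeasurableSpace Ω] {f : Ω → ℝ≥0} (hf : Continuous f) :
    LowerSemicontinuous fun γ : ProbabilityMeasure Ω => ∫⁻ x, f x ∂(γ : Measure Ω) := by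
  have h : ∀ γ : ProbabilityMeasure Ω, ∫⁻ x, f x ∂(γ : Measure Ω)
      = ⨆ N : ℕ, ∫⁻ x, ((min (f x) N : ℝ≥0) : ℝ≥0∞) ∂(γ : Measure Ω) := by
    intro γ
    rw [← lintegral_iSup]
    · refine lintegral_congr fun x => ?_
      refine le_antisymm ?_ (iSup_le fun N => by exact_mod_cast min_le_left _ _)
      obtain ⟨N, hN⟩ := exists_nat_ge (f x)
      exact le_iSup_of_le N (by simp [min_eq_left hN])
    · exact fun N => (hf.min continuous_const).measurable.coe_nnreal_ennreal
    · intro N M hNM x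
      exact ENNReal.coe_le_coe.2 (min_le_min_left _ (by exact_mod_cast hNM))
  simp_rw [h]
  refine lowerSemicontinuous_iSup fun N => Continuous.lowerSemicontinuous ?_
  let g : BoundedContinuousFunction Ω ℝ≥0 :=
    BoundedContinuousFunction.mkOfBound ⟨fun x => min (f x) N, hf.min continuous_const⟩ N
      (fun x y => by
        rw [NNReal.dist_eq]
        have hx : ((min (f x) N : ℝ≥0) : ℝ) ≤ N := by exact_mod_cast min_le_right (f x) (N : ℝ≥0)
        have hy : ((min (f y) N : ℝ≥0) : ℝ) ≤ N := by exact_mod_cast min_le_right (f y) (N : ℝ≥0)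
        have hx0 := (min (f x) (N : ℝ≥0)).coe_nonneg
        have hy0 := (min (f y) (N : ℝ≥0)).coe_nonneg
        exact abs_sub_le_iff.2 ⟨by simp, by simp⟩)
  exact continuous_iff_continuousAt.2 fun γ =>
    ProbabilityMeasure.tendsto_iff_forall_lintegral_tendsto.1 Filter.tendsto_id g

end WeakConvergence

/-! ### Compactness of couplings, existence of optimal ones, finiteness of the cost, mixtures. -/

section Couplings

variable {n : ℕ}

local notation "𝔼" => EuclideanSpace ℝ (Fin n)

/-- Prokhorov: the marginals are tight, hence so are the couplings, and the marginal constraints are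
weakly closed. -/
theorem isCompact_couplings (ν μ : Measure 𝔼)
    [IsProbabilityMeasure ν] [IsProbabilityMeasure μ] :
    IsCompact {γ : ProbabilityMeasure (𝔼 × 𝔼) |
      (γ : Measure (𝔼 × 𝔼)) ∈ couplings ν μ} := by
  set S := {γ : ProbabilityMeasure (𝔼 × 𝔼) | (γ : Measure (𝔼 × 𝔼)) ∈ couplings ν μ}
  have hclosed : IsClosed S := by
    let ν' : ProbabilityMeasure 𝔼 := ⟨ν, inferInstance⟩
    let μ' : ProbabilityMeasure 𝔼 := ⟨μ, inferInstance⟩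
    have : S = {γ | γ.map continuous_fst.measurable.aemeasurable = ν'} ∩
        {γ | γ.map continuous_snd.measurable.aemeasurable = μ'} := by
      ext γ
      exact ⟨fun h => ⟨Subtype.ext h.2.1, Subtype.ext h.2.2⟩,
        fun h => ⟨γ.2, congrArg Subtype.val h.1, congrArg Subtype.val h.2⟩⟩
    rw [this]
    exact (isClosed_eq (ProbabilityMeasure.continuous_map continuous_fst) continuous_const).inter
      (isClosed_eq (ProbabilityMeasure.continuous_map continuous_snd) continuous_const)
  rw [← hclosed.closure_eq]
  refine isCompact_closure_of_isTightMeasureSet ?_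
  rw [isTightMeasureSet_iff_exists_isCompact_measure_compl_le]
  intro ε hε
  have hε2 : 0 < ε / 2 := ENNReal.half_pos hε.ne'
  obtain ⟨K, hK, hKν⟩ := isTightMeasureSet_iff_exists_isCompact_measure_compl_le.1
    (isTightMeasureSet_singleton (μ := ν)) (ε / 2) hε2
  obtain ⟨L, hL, hLμ⟩ := isTightMeasureSet_iff_exists_isCompact_measure_compl_le.1
    (isTightMeasureSet_singleton (μ := μ)) (ε / 2) hε2
  refine ⟨K ×ˢ L, hK.prod hL, ?_⟩
  rintro _ ⟨γ, hγ, rfl⟩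
  have h1 : (γ : Measure (𝔼 × 𝔼)) (Prod.fst ⁻¹' Kᶜ) ≤ ε / 2 := by
    rw [← Measure.map_apply measurable_fst hK.measurableSet.compl, hγ.2.1]
    exact hKν ν rfl
  have h2 : (γ : Measure (𝔼 × 𝔼)) (Prod.snd ⁻¹' Lᶜ) ≤ ε / 2 := by
    rw [← Measure.map_apply measurable_snd hL.measurableSet.compl, hγ.2.2]
    exact hLμ μ rfl
  calc (γ : Measure (𝔼 × 𝔼)) (K ×ˢ L)ᶜ
      ≤ (γ : Measure (𝔼 × 𝔼)) (Prod.fst ⁻¹' Kᶜ ∪ Prod.snd ⁻¹' Lᶜ) := by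
        refine measure_mono fun p hp => ?_
        simp only [Set.mem_compl_iff, Set.mem_prod, not_and_or] at hp
        exact hp
    _ ≤ ε / 2 + ε / 2 := (measure_union_le _ _).trans (add_le_add h1 h2)
    _ = ε := ENNReal.add_halves ε

theorem prod_mem_couplings (ν μ : Measure 𝔼)
    [IsProbabilityMeasure ν] [IsProbabilityMeasure μ] : ν.prod μ ∈ couplings ν μ :=
  ⟨inferInstance, by simp [Measure.map_fst_prod], by simp [Measure.map_snd_prod]⟩

theorem W2sq_le {ν μ : Measure 𝔼}
    {γ : Measure (𝔼 × 𝔼)} (h : γ ∈ couplings ν μ) :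
    W2sq ν μ ≤ ∫⁻ p, ‖p.1 - p.2‖ₑ ^ 2 ∂γ :=
  iInf₂_le γ h

theorem exists_optimal_coupling (ν μ : Measure 𝔼)
    [IsProbabilityMeasure ν] [IsProbabilityMeasure μ] :
    ∃ γ ∈ couplings ν μ, ∫⁻ p, ‖p.1 - p.2‖ₑ ^ 2 ∂γ = W2sq ν μ := by
  have hlsc : LowerSemicontinuous fun γ : ProbabilityMeasure (𝔼 × 𝔼) =>
      ∫⁻ p, ‖p.1 - p.2‖ₑ ^ 2 ∂(γ : Measure (𝔼 × 𝔼)) := by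
    have hf : Continuous fun p : 𝔼 × 𝔼 => ‖p.1 - p.2‖₊ ^ 2 := by fun_prop
    simpa [enorm_eq_nnnorm] using lowerSemicontinuous_lintegral_coe hf
  obtain ⟨γ, hγ, hmin⟩ := (hlsc.lowerSemicontinuousOn _).exists_isMinOn
    ⟨⟨ν.prod μ, inferInstance⟩, prod_mem_couplings ν μ⟩ (isCompact_couplings ν μ)
  refine ⟨γ, hγ, le_antisymm (le_iInf₂ fun γ' hγ' => ?_) (W2sq_le hγ)⟩
  exact hmin (show (⟨γ', hγ'.1⟩ : ProbabilityMeasure (𝔼 × 𝔼)) ∈ _ from hγ')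

theorem W2sq_lt_top {ν μ : Measure 𝔼} (hν : ν ∈ P2 n) (hμ : μ ∈ P2 n) :
    W2sq ν μ < ∞ := by
  have := hν.1
  have := hμ.1
  refine (W2sq_le (prod_mem_couplings ν μ)).trans_lt ?_
  have hle : ∀ p : 𝔼 × 𝔼, ‖p.1 - p.2‖ₑ ^ 2 ≤ 2 * (‖p.1‖ₑ ^ 2 + ‖p.2‖ₑ ^ 2) := by
    intro p
    have h : ‖p.1 - p.2‖₊ ^ 2 ≤ 2 * (‖p.1‖₊ ^ 2 + ‖p.2‖₊ ^ 2) := by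
      have h1 := nnnorm_sub_le p.1 p.2
      rw [← NNReal.coe_le_coe] at h1 ⊢
      push_cast at h1 ⊢
      nlinarith [sq_nonneg (‖p.1‖ - ‖p.2‖), norm_nonneg (p.1 - p.2)]
    simp only [enorm_eq_nnnorm]
    exact_mod_cast h
  refine (lintegral_mono hle).trans_lt ?_
  rw [lintegral_const_mul _ (by fun_prop), lintegral_add_left (by fun_prop)]
  have e1 : ∫⁻ p : 𝔼 × 𝔼, ‖p.1‖ₑ ^ 2 ∂(ν.prod μ) = ∫⁻ x, ‖x‖ₑ ^ 2 ∂ν := by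
    conv_rhs => rw [← (prod_mem_couplings ν μ).2.1]
    rw [lintegral_map (by fun_prop) measurable_fst]
  have e2 : ∫⁻ p : 𝔼 × 𝔼, ‖p.2‖ₑ ^ 2 ∂(ν.prod μ) = ∫⁻ x, ‖x‖ₑ ^ 2 ∂μ := by
    conv_rhs => rw [← (prod_mem_couplings ν μ).2.2]
    rw [lintegral_map (by fun_prop) measurable_snd]
  rw [e1, e2]
  exact ENNReal.mul_lt_top (by simp) (ENNReal.add_lt_top.2 ⟨hν.2, hμ.2⟩)

theorem convex_P2 (n : ℕ) : Convex ℝ≥0 (P2 n) := by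
  intro μ₀ h₀ μ₁ h₁ a b _ _ hab
  have := h₀.1
  have := h₁.1
  refine ⟨⟨?_⟩, ?_⟩
  · simpa using by exact_mod_cast hab
  · rw [lintegral_add_measure, lintegral_smul_measure, lintegral_smul_measure]
    exact ENNReal.add_lt_top.2
      ⟨ENNReal.mul_lt_top ENNReal.coe_lt_top h₀.2, ENNReal.mul_lt_top ENNReal.coe_lt_top h₁.2⟩

theorem smul_add_smul_mem_couplings {ν μ₀ μ₁ : Measure 𝔼}
    {γ₀ γ₁ : Measure (𝔼 × 𝔼)}
    (h₀ : γ₀ ∈ couplings ν μ₀) (h₁ : γ₁ ∈ couplings ν μ₁) {a b : ℝ≥0} (hab : a + b = 1) :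
    a • γ₀ + b • γ₁ ∈ couplings ν (a • μ₀ + b • μ₁) := by
  have := h₀.1
  have := h₁.1
  refine ⟨⟨?_⟩, ?_, ?_⟩
  · simpa using by exact_mod_cast hab
  · rw [Measure.map_add _ _ measurable_fst, Measure.map_smul, Measure.map_smul, h₀.2.1, h₁.2.1,
      ← add_smul, hab, one_smul]
  · rw [Measure.map_add _ _ measurable_snd, Measure.map_smul, Measure.map_smul, h₀.2.2, h₁.2.2]

end Couplings

/-! ### Optimal couplings have monotone support. -/

section OptimalCouplings

variable {n : ℕ}

local notation "𝔼" => EuclideanSpace ℝ (Fin n)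

theorem enorm_sq_add_enorm_sq_lt_of_inner_neg {E : Type*} [NormedAddCommGroup E]
    [InnerProductSpace ℝ E] {x x' y y' : E} (h : inner ℝ (x - x') (y - y') < 0) :
    ‖x - y'‖ₑ ^ 2 + ‖x' - y‖ₑ ^ 2 < ‖x - y‖ₑ ^ 2 + ‖x' - y'‖ₑ ^ 2 := by
  have h' : ‖x - y'‖₊ ^ 2 + ‖x' - y‖₊ ^ 2 < ‖x - y‖₊ ^ 2 + ‖x' - y'‖₊ ^ 2 := by
    rw [← NNReal.coe_lt_coe]
    push_cast
    simp only [inner_sub_left, inner_sub_right] at h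
    simp only [norm_sub_sq_real]
    linarith
  simp only [enorm_eq_nnnorm]
  exact_mod_cast h'

/-- An optimal coupling gives no mass to the pairs of points whose targets should be exchanged:
exchanging them, for an independent pair of points, would give a cheaper coupling. -/
theorem prod_self_inner_neg_eq_zero {ν μ : Measure 𝔼} {γ : Measure (𝔼 × 𝔼)}
    (hγ : γ ∈ couplings ν μ) (hopt : ∫⁻ p, ‖p.1 - p.2‖ₑ ^ 2 ∂γ ≤ W2sq ν μ)
    (hfin : ∫⁻ p, ‖p.1 - p.2‖ₑ ^ 2 ∂γ ≠ ∞) :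
    (γ.prod γ) {z | inner ℝ (z.1.1 - z.2.1) (z.1.2 - z.2.2) < (0 : ℝ)} = 0 := by
  classical
  have := hγ.1
  set S : Set ((𝔼 × 𝔼) × (𝔼 × 𝔼)) :=
    {z | inner ℝ (z.1.1 - z.2.1) (z.1.2 - z.2.2) < (0 : ℝ)} with hS
  have hSm : MeasurableSet S := by
    refine IsOpen.measurableSet (isOpen_lt ?_ continuous_const)
    fun_prop
  have hswap : MeasurePreserving Prod.swap (γ.prod γ) (γ.prod γ) := Measure.measurePreserving_swap
  have hSswap : Prod.swap ⁻¹' S = S := by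
    ext z
    simp only [hS, Set.mem_preimage, Set.mem_ofPred_eq, Prod.fst_swap, Prod.snd_swap]
    rw [← inner_neg_neg, neg_sub, neg_sub]
  have hsymm : ∀ f : (𝔼 × 𝔼) × (𝔼 × 𝔼) → ℝ≥0∞, Measurable f →
      ∫⁻ z in S, f z.swap ∂(γ.prod γ) = ∫⁻ z in S, f z ∂(γ.prod γ) := by
    intro f hf
    conv_lhs => rw [← hSswap]
    exact hswap.setLIntegral_comp_preimage hSm hf
  have hfst : (γ.prod γ).map Prod.fst = γ := by simp [Measure.map_fst_prod]
  have hsplit : ∀ f : 𝔼 × 𝔼 → ℝ≥0∞, Measurable f → ∫⁻ p, f p ∂γ =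
      ∫⁻ z in S, f z.1 ∂(γ.prod γ) + ∫⁻ z in Sᶜ, f z.1 ∂(γ.prod γ) := by
    intro f hf
    rw [lintegral_add_compl _ hSm]
    conv_lhs => rw [← hfst]
    rw [lintegral_map hf measurable_fst]
  -- For independent `p`, `q`, the target of `p` is replaced by that of `q` on `S`. Since `S` is
  -- symmetric under the swap, the second marginal is unchanged.
  let Φ : (𝔼 × 𝔼) × (𝔼 × 𝔼) → 𝔼 × 𝔼 := S.piecewise (fun z => (z.1.1, z.2.2)) Prod.fst
  have hΦ : Measurable Φ := Measurable.piecewise hSm (by fun_prop) measurable_fst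
  have hΦint : ∀ f : 𝔼 × 𝔼 → ℝ≥0∞, Measurable f → ∫⁻ p, f p ∂(γ.prod γ).map Φ =
      ∫⁻ z in S, f (z.1.1, z.2.2) ∂(γ.prod γ) + ∫⁻ z in Sᶜ, f z.1 ∂(γ.prod γ) := by
    intro f hf
    rw [lintegral_map hf hΦ, ← lintegral_add_compl _ hSm]
    congr 1
    · refine setLIntegral_congr_fun hSm fun z hz => ?_
      simp only [Φ, Set.piecewise_eq_of_mem _ _ _ hz]
    · refine setLIntegral_congr_fun hSm.compl fun z hz => ?_
      simp only [Φ, Set.piecewise_eq_of_notMem _ _ _ hz]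
  have hΦc : (γ.prod γ).map Φ ∈ couplings ν μ := by
    refine ⟨Measure.isProbabilityMeasure_map hΦ.aemeasurable, ?_, ?_⟩
    · rw [← hγ.2.1]
      refine Measure.ext_of_lintegral _ fun f hf => ?_
      rw [lintegral_map hf measurable_fst, lintegral_map hf measurable_fst,
        hΦint (fun p => f p.1) (hf.comp measurable_fst),
        hsplit (fun p => f p.1) (hf.comp measurable_fst)]
    · rw [← hγ.2.2]
      refine Measure.ext_of_lintegral _ fun f hf => ?_
      rw [lintegral_map hf measurable_snd, lintegral_map hf measurable_snd,
        hΦint (fun p => f p.2) (hf.comp measurable_snd),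
        hsplit (fun p => f p.2) (hf.comp measurable_snd)]
      congr 1
      exact hsymm (fun z => f z.1.2) (hf.comp (by fun_prop))
  let c : 𝔼 × 𝔼 → ℝ≥0∞ := fun p => ‖p.1 - p.2‖ₑ ^ 2
  have hc : Measurable c := by fun_prop
  have hle : ∫⁻ z in S, c z.1 ∂(γ.prod γ) ≤ ∫⁻ z in S, c (z.1.1, z.2.2) ∂(γ.prod γ) := by
    have h := hopt.trans (W2sq_le hΦc)
    have e := hsplit c hc
    rw [hΦint _ hc, hsplit _ hc] at h
    refine (ENNReal.add_le_add_iff_right ?_).1 h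
    exact ne_top_of_le_ne_top hfin (le_add_self.trans_eq e.symm)
  have hSfin : ∫⁻ z in S, c z.1 ∂(γ.prod γ) ≠ ∞ :=
    ne_top_of_le_ne_top hfin (le_self_add.trans_eq (hsplit c hc).symm)
  -- Symmetrizing over the swap turns `hle` into a bound contradicting the pointwise strict gain on
  -- `S`, unless `S` is null.
  have hsum : ∫⁻ z in S, (c z.1 + c z.2) ∂(γ.prod γ) ≤
      ∫⁻ z in S, (c (z.1.1, z.2.2) + c (z.2.1, z.1.2)) ∂(γ.prod γ) := by
    rw [lintegral_add_left (by fun_prop), lintegral_add_left (by fun_prop)]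
    refine add_le_add hle ?_
    rw [← hsymm (fun z => c z.2) (by fun_prop), ← hsymm (fun z => c (z.2.1, z.1.2)) (by fun_prop)]
    exact hle
  have hsumfin : ∫⁻ z in S, (c z.1 + c z.2) ∂(γ.prod γ) ≠ ∞ := by
    rw [lintegral_add_left (by fun_prop), ← hsymm (fun z => c z.2) (by fun_prop)]
    exact ENNReal.add_ne_top.2 ⟨hSfin, hSfin⟩
  by_contra hne
  have hlt : ∀ z ∈ S, c (z.1.1, z.2.2) + c (z.2.1, z.1.2) < c z.1 + c z.2 :=
    fun z hz => enorm_sq_add_enorm_sq_lt_of_inner_neg hz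
  refine hsum.not_gt (setLIntegral_strict_mono hSm hne (by fun_prop) ?_ ?_)
  · exact ne_top_of_le_ne_top hsumfin (setLIntegral_mono' hSm fun z hz => (hlt z hz).le)
  · exact Filter.Eventually.of_forall hlt

/-- The violating pairs form an open set; neighborhoods of two support points have positive mass, so
a violating pair of them would give this set positive product measure. -/
theorem isMonotoneRel_support_of_optimal {ν μ : Measure 𝔼} {γ : Measure (𝔼 × 𝔼)}
    (hγ : γ ∈ couplings ν μ) (hopt : ∫⁻ p, ‖p.1 - p.2‖ₑ ^ 2 ∂γ ≤ W2sq ν μ)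
    (hfin : ∫⁻ p, ‖p.1 - p.2‖ₑ ^ 2 ∂γ ≠ ∞) : IsMonotoneRel γ.support := by
  intro p hp q hq
  have := hγ.1
  by_contra! hneg
  have hopen : IsOpen {z : (𝔼 × 𝔼) × (𝔼 × 𝔼) |
      inner ℝ (z.1.1 - z.2.1) (z.1.2 - z.2.2) < (0 : ℝ)} :=
    isOpen_lt (by fun_prop) continuous_const
  obtain ⟨U, V, hU, hV, hpU, hqV, hUV⟩ := isOpen_prod_iff.1 hopen p q hneg
  have h0 := measure_mono_null hUV (prod_self_inner_neg_eq_zero hγ hopt hfin)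
  rw [Measure.prod_prod] at h0
  have hpos := ENNReal.mul_pos (Measure.mem_support_iff_forall p |>.1 hp U (hU.mem_nhds hpU)).ne'
    (Measure.mem_support_iff_forall q |>.1 hq V (hV.mem_nhds hqV)).ne'
  exact hpos.ne' h0

/-- If a closed monotone relation carries two couplings of an absolutely continuous measure `ν`,
then their second marginals agree. -/
theorem eq_of_couplings_of_isMonotoneRel {ν μ₀ μ₁ : Measure 𝔼} (hac : ν ≪ volume)
    {γ₀ γ₁ : Measure (𝔼 × 𝔼)} (h₀ : γ₀ ∈ couplings ν μ₀) (h₁ : γ₁ ∈ couplings ν μ₁)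
    {G : Set (𝔼 × 𝔼)} (hGc : IsClosed G) (hG : IsMonotoneRel G) (hG₀ : γ₀ Gᶜ = 0)
    (hG₁ : γ₁ Gᶜ = 0) : μ₀ = μ₁ := by
  have hnull := hac (hG.addHaar_multivalued_eq_zero volume)
  set B : Set 𝔼 := {x | ∃ y y', y ≠ y' ∧ (x, y) ∈ G ∧ (x, y') ∈ G} with hB
  -- Off the null set `B` the fiber of `G` is at most one point, so for `(x, y)` in `G` the
  -- condition `y ∈ C` depends on `x` alone. The right-hand side does not involve `γ` or `μ`.
  have key : ∀ (μ : Measure 𝔼) (γ : Measure (𝔼 × 𝔼)), γ ∈ couplings ν μ → γ Gᶜ = 0 →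
      ∀ C : Set 𝔼, IsClosed C → μ C = ν (Prod.fst '' (G ∩ Prod.snd ⁻¹' C)) := by
    intro μ γ hγ hγG C hC
    -- A closed set in a σ-compact space is a countable union of compacts, hence so is its
    -- projection.
    have hPm : MeasurableSet (Prod.fst '' (G ∩ Prod.snd ⁻¹' C)) := by
      have hcl : IsClosed (G ∩ Prod.snd ⁻¹' C) := hGc.inter (hC.preimage continuous_snd)
      rw [← Set.inter_univ (G ∩ Prod.snd ⁻¹' C), ← iUnion_compactCovering (𝔼 × 𝔼),
        Set.inter_iUnion, Set.image_iUnion]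
      exact MeasurableSet.iUnion fun k =>
        (((isCompact_compactCovering _ k).inter_left hcl).image continuous_fst).measurableSet
    have hBγ : γ (Prod.fst ⁻¹' toMeasurable ν B) = 0 := by
      rw [← Measure.map_apply measurable_fst (measurableSet_toMeasurable _ _), hγ.2.1,
        measure_toMeasurable, hnull]
    rw [← hγ.2.1, ← hγ.2.2, Measure.map_apply measurable_fst hPm,
      Measure.map_apply measurable_snd hC.measurableSet]
    refine measure_congr (Filter.eventuallyEq_set.2 ?_)
    filter_upwards [measure_eq_zero_iff_ae_notMem.1 hγG, measure_eq_zero_iff_ae_notMem.1 hBγ]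
      with p hpG hpB
    rw [Set.notMem_compl_iff] at hpG
    refine ⟨fun hp => ⟨p, ⟨hpG, hp⟩, rfl⟩, ?_⟩
    rintro ⟨q, ⟨hqG, hqC⟩, hqp⟩
    by_contra hp
    refine hpB (subset_toMeasurable ν B ⟨p.2, q.2, ?_, hpG, hqp ▸ hqG⟩)
    intro h
    exact hp (by rw [Set.mem_preimage, h]; exact hqC)
  have := h₀.1
  have : IsProbabilityMeasure μ₀ :=
    h₀.2.2 ▸ Measure.isProbabilityMeasure_map measurable_snd.aemeasurable
  refine ext_of_generate_finite _
    ((BorelSpace.measurable_eq (α := 𝔼)).trans borel_eq_generateFrom_isClosed)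
    isPiSystem_isClosed (fun C hC => ?_) ?_
  · rw [key μ₀ γ₀ h₀ hG₀ C hC, key μ₁ γ₁ h₁ hG₁ C hC]
  · rw [key μ₀ γ₀ h₀ hG₀ _ isClosed_univ, key μ₁ γ₁ h₁ hG₁ _ isClosed_univ]

end OptimalCouplings

/-! ### Convexity and strict convexity. -/

section Convexity

variable {n : ℕ}

local notation "𝔼" => EuclideanSpace ℝ (Fin n)

theorem lintegral_smul_add_smul {α : Type*} [MeasurableSpace α] (γ₀ γ₁ : Measure α) (a b : ℝ≥0)
    (f : α → ℝ≥0∞) :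
    ∫⁻ p, f p ∂(a • γ₀ + b • γ₁) = a * ∫⁻ p, f p ∂γ₀ + b * ∫⁻ p, f p ∂γ₁ := by
  rw [lintegral_add_measure, lintegral_smul_measure, lintegral_smul_measure]
  rfl

theorem W2sq_smul_add_smul_le {ν μ₀ μ₁ : Measure 𝔼} (hν : ν ∈ P2 n) (h₀ : μ₀ ∈ P2 n)
    (h₁ : μ₁ ∈ P2 n) {a b : ℝ≥0} (hab : a + b = 1) :
    W2sq ν (a • μ₀ + b • μ₁) ≤ a * W2sq ν μ₀ + b * W2sq ν μ₁ := by
  have := hν.1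
  have := h₀.1
  have := h₁.1
  obtain ⟨γ₀, hγ₀, e₀⟩ := exists_optimal_coupling ν μ₀
  obtain ⟨γ₁, hγ₁, e₁⟩ := exists_optimal_coupling ν μ₁
  rw [← e₀, ← e₁, ← lintegral_smul_add_smul]
  exact W2sq_le (smul_add_smul_mem_couplings hγ₀ hγ₁ hab)

theorem W2sq_smul_add_smul_lt {ν μ₀ μ₁ : Measure 𝔼} (hν : ν ∈ P2 n) (hac : ν ≪ volume)
    (h₀ : μ₀ ∈ P2 n) (h₁ : μ₁ ∈ P2 n) (hne : μ₀ ≠ μ₁) {a b : ℝ≥0} (ha : 0 < a) (hb : 0 < b)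
    (hab : a + b = 1) :
    W2sq ν (a • μ₀ + b • μ₁) < a * W2sq ν μ₀ + b * W2sq ν μ₁ := by
  have := hν.1
  have := h₀.1
  have := h₁.1
  obtain ⟨γ₀, hγ₀, e₀⟩ := exists_optimal_coupling ν μ₀
  obtain ⟨γ₁, hγ₁, e₁⟩ := exists_optimal_coupling ν μ₁
  have hγ := smul_add_smul_mem_couplings hγ₀ hγ₁ hab
  have := hγ.1
  by_contra! hopt
  rw [← e₀, ← e₁, ← lintegral_smul_add_smul] at hopt
  have hfin := hopt.trans_lt
    (W2sq_lt_top hν (convex_P2 n h₀ h₁ zero_le zero_le hab))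
  have hmono := isMonotoneRel_support_of_optimal hγ hopt hfin.ne
  have hsupp : (a • γ₀ + b • γ₁) (a • γ₀ + b • γ₁).supportᶜ = 0 := Measure.measure_compl_support
  set G := (a • γ₀ + b • γ₁).support
  -- Both weights are positive, so each coupling separately vanishes off `G`.
  rw [Measure.add_apply, Measure.smul_apply, Measure.smul_apply, add_eq_zero,
    smul_eq_zero_iff_right ha.ne', smul_eq_zero_iff_right hb.ne'] at hsupp
  exact hne (eq_of_couplings_of_isMonotoneRel hac hγ₀ hγ₁ Measure.isClosed_support hmono
    hsupp.1 hsupp.2)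

theorem toReal_smul_add_smul {a b : ℝ≥0} {x y : ℝ≥0∞} (hx : x ≠ ∞) (hy : y ≠ ∞) :
    (a * x + b * y : ℝ≥0∞).toReal = a • x.toReal + b • y.toReal := by
  rw [ENNReal.toReal_add (by finiteness) (by finiteness), ENNReal.toReal_mul, ENNReal.toReal_mul]
  rfl

end Convexity

theorem lemma3p2p1 (n : ℕ) (ν : Measure (EuclideanSpace ℝ (Fin n))) (hν : ν ∈ P2 n) :
    (∀ μ ∈ P2 n, W2sq ν μ < ∞) ∧
    ConvexOn ℝ≥0 (P2 n) (fun μ => (W2sq ν μ).toReal) ∧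
    (ν ≪ volume → StrictConvexOn ℝ≥0 (P2 n) (fun μ => (W2sq ν μ).toReal)) := by
  have hfin : ∀ μ ∈ P2 n, W2sq ν μ ≠ ∞ := fun μ hμ => (W2sq_lt_top hν hμ).ne
  refine ⟨fun μ hμ => W2sq_lt_top hν hμ, ⟨convex_P2 n, ?_⟩, fun hac => ⟨convex_P2 n, ?_⟩⟩
  · intro μ₀ h₀ μ₁ h₁ a b _ _ hab
    have f₀ := hfin _ h₀
    have f₁ := hfin _ h₁
    simp only [← toReal_smul_add_smul f₀ f₁]
    exact ENNReal.toReal_mono (by finiteness) (W2sq_smul_add_smul_le hν h₀ h₁ hab)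
  · intro μ₀ h₀ μ₁ h₁ hne a b ha hb hab
    have f₀ := hfin _ h₀
    have f₁ := hfin _ h₁
    simp only [← toReal_smul_add_smul f₀ f₁]
    exact ENNReal.toReal_strict_mono (by finiteness)
      (W2sq_smul_add_smul_lt hν hac h₀ h₁ hne ha hb hab)
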